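/- All graphs are finite and simple. A cooperative coloring of a family $(G_1,\dots,G_m)$ of (not necessarily distinct) graphs on a common vertex set $V$ is a choice of sets $I_1,\dots,I_m\subseteq V$ such that $I_i$ is independent in $G_i$ for each $i$ and $\bigcup_{i=1}^m I_i=V$. For a graph class $\mathcal G$ and $d\in\mathbb N$, let $m_{\mathcal G}(d)$ be the minimum $m$ such that every family $(G_1,\dots,G_m)$ of graphs in $\mathcal G$ on a common vertex set with maximum degrees $\Delta(G_j)\le d$ for all $j$ has a cooperative coloring. Let $\mathcal W^*$ be the class of graphs each of whose connected components is a wheel $C_n\vee K_1$ ($n\ge 3$) or a fan $P_n\vee K_1$ ($n\ge 1$), where $C_n$ and $P_n$ are the cycle and the path on $n$ vertices and $\vee$ denotes the join. Then, for every $d\ge 3$, $m_{\mathcal W^*}(d)$ is finite (a minimum $m$ exists), and $$m_{\mathcal W^*}(d)=(1+o(1))\,\frac{\log d}{\log\log d}\qquad (d\to\infty);$$ that is, there is a function $\varepsilon:\mathbb N\to\mathbb R$ with $\varepsilon(d)\to 0$ as $d\to\infty$ such that $m_{\mathcal W^*}(d)=(1+\varepsilon(d))\frac{\log d}{\log\log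 d}$ for all $d\ge 3$. -/

import Mathlib

open Filter Topology

/-- `I` is a cooperative coloring of the family `G`: each `I i` is an independent set of `G i`,
and the sets `I i` together cover the common vertex set. -/
def IsCooperativeColoring {V : Type} {m : ℕ} (G : Fin m → SimpleGraph V) (I : Fin m → Set V) :
    Prop :=
  (∀ i, (G i).IsIndepSet (I i)) ∧ ⋃ i, I i = Set.univ

/-- A graph class: a property of simple graphs. -/
abbrev GraphClass : Type 1 := ∀ ⦃V : Type⦄, SimpleGraph V → Prop

/-- The set of all `m` such that every family of `m` (not necessarily distinct) graphs from the
class `𝒢`, on a common finite vertex set and with maximum degrees at most `d`, has a cooperative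
coloring. -/
def cooperativeNumbers (𝒢 : GraphClass) (d : ℕ) : Set ℕ :=
  {m | ∀ (V : Type) [Fintype V] (G : Fin m → SimpleGraph V) [∀ i, DecidableRel (G i).Adj],
    (∀ i, 𝒢 (G i)) → (∀ i, (G i).maxDegree ≤ d) → ∃ I, IsCooperativeColoring G I}

/-- `m_𝒢(d)`, the minimum of `cooperativeNumbers 𝒢 d`. The infimum is taken in `ℕ`, so it is the
minimum exactly when that set is nonempty. -/
noncomputable def cooperativeNumber (𝒢 : GraphClass) (d : ℕ) : ℕ :=
  sInf (cooperativeNumbers 𝒢 d)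

/-- The join `G ∨ H`: the disjoint union of `G` and `H` together with all edges between them. -/
def graphJoin {V W : Type} (G : SimpleGraph V) (H : SimpleGraph W) : SimpleGraph (V ⊕ W) :=
  (G ⊕g H) ⊔ completeBipartiteGraph V W

/-- The wheel `C_n ∨ K_1` (meant for `3 ≤ n`). -/
def wheelGraph (n : ℕ) : SimpleGraph (Fin n ⊕ Unit) :=
  graphJoin (SimpleGraph.cycleGraph n) (⊥ : SimpleGraph Unit)

/-- The fan `P_n ∨ K_1`, where `P_n` is the path on `n` vertices (meant for `1 ≤ n`). -/
def fanGraph (n : ℕ) : SimpleGraph (Fin n ⊕ Unit) :=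
  graphJoin (SimpleGraph.pathGraph n) (⊥ : SimpleGraph Unit)

/-- The class of graphs all of whose connected components are wheels or fans. -/
def wheelFanClass : GraphClass := fun _ G =>
  ∀ c : G.ConnectedComponent,
    (∃ n, 3 ≤ n ∧ Nonempty (c.toSimpleGraph ≃g wheelGraph n)) ∨
      (∃ n, 1 ≤ n ∧ Nonempty (c.toSimpleGraph ≃g fanGraph n))

/-! Each component has a hub adjacent to all its other vertices, and the remaining rim edges give
each non-hub degree at most 2. Only hub edges matter asymptotically.

Upper bound: call a vertex big if it is a hub in at least `k` colors. It claims one of `k` such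
colors at random. Big vertices never clash, since distinct hubs of one graph are not adjacent. A
small vertex may use the colors in which it is a non-hub and its hub has not claimed that color. A
vertex claims only one color, so the hubs spoiling `r` given colors are distinct, and they do so
with probability at most `k^(-r)`. The local lemma leaves 32 colors to every small vertex
(`exists_claims`). Then only rim edges remain, and a second local lemma handles them
(`exists_list_coloring`). With `k` a small fraction of `m` and `r` close to `m`, this works for `log
d ≤ (1 - δ) m log m`.

Lower bound (`notMem_cooperativeNumbers_of_le`): the vertices are the duplicate-free lists of
colors, and the hub of `l` in color `c` is the part of `l` before `c`. In a cooperative coloring,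
repeatedly appending to a list its own color never repeats a color, which is absurd after `m` steps.
Degrees stay below `(m + 1) ^ m`.

Together, `log d` is asymptotic to `M log M` for `M = m(d)`, and inverting this gives the theorem.
-/

/-! ### The local lemma for uniformly random functions -/

/-- Swapping coordinates: an event determined by the coordinates in `T` and an event determined by
the remaining coordinates are independent under the uniform measure. -/
theorem card_inter_mul_card_le {V α : Type*} [Fintype V] [DecidableEq V] [Fintype α]
    [DecidableEq α] (T : Finset V) (A B : Finset (V → α))
    (hA : ∀ x y : V → α, (∀ v ∈ T, x v = y v) → x ∈ A → y ∈ A)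
    (hB : ∀ x y : V → α, (∀ v ∉ T, x v = y v) → x ∈ B → y ∈ B) :
    (A ∩ B).card * Fintype.card (V → α) ≤ A.card * B.card := by
  rw [← Finset.card_univ, ← Finset.card_product, ← Finset.card_product]
  refine Finset.card_le_card_of_injOn
    (fun z => (fun v => if v ∈ T then z.1 v else z.2 v, fun v => if v ∈ T then z.2 v else z.1 v))
    ?_ ?_
  · rintro ⟨z, w⟩ hz
    simp only [Finset.coe_product, Set.mem_prod, Finset.mem_coe, Finset.mem_inter] at hz ⊢
    exact ⟨hA z _ (fun v hv => by simp [hv]) hz.1.1, hB z _ (fun v hv => by simp [hv]) hz.1.2⟩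
  · rintro ⟨z, w⟩ - ⟨z', w'⟩ - h
    simp only [Prod.mk.injEq] at h
    refine Prod.ext (funext fun v => ?_) (funext fun v => ?_)
    · by_cases hv : v ∈ T
      · simpa [hv] using congrFun h.1 v
      · simpa [hv] using congrFun h.2 v
    · by_cases hv : v ∈ T
      · simpa [hv] using congrFun h.2 v
      · simpa [hv] using congrFun h.1 v

/-- The outcomes avoiding all the events `A j`, `j ∈ S`. -/
def avoiding {ι Ω : Type*} [Fintype Ω] [DecidableEq Ω] (A : ι → Finset Ω) (S : Finset ι) :
    Finset Ω :=
  Finset.univ.filter fun x => ∀ j ∈ S, x ∉ A j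

theorem mem_avoiding {ι Ω : Type*} [Fintype Ω] [DecidableEq Ω] {A : ι → Finset Ω}
    {S : Finset ι} {x : Ω} : x ∈ avoiding A S ↔ ∀ j ∈ S, x ∉ A j := by
  simp [avoiding]

/-- The main estimate of the local lemma: conditioning on avoiding other events at most doubles
the bound `1 / P` for the probability of an event. -/
theorem card_inter_avoiding_mul_le {ι Ω : Type*} [DecidableEq ι] [Fintype Ω] [DecidableEq Ω]
    (A : ι → Finset Ω) (R : ι → ι → Prop) [DecidableRel R] (P D : ℕ)
    (hind : ∀ (i : ι) (S : Finset ι), (∀ j ∈ S, ¬ R i j) →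
      (A i ∩ avoiding A S).card * P ≤ (avoiding A S).card)
    (hD : ∀ (i : ι) (S : Finset ι), (S.filter (R i)).card ≤ D) (hP : 4 * D ≤ P)
    (S : Finset ι) : ∀ i, (A i ∩ avoiding A S).card * P ≤ 2 * (avoiding A S).card := by
  induction S using Finset.strongInduction with
  | H S ih =>
    intro i
    set S₂ := S.filter fun j => ¬ R i j with hS₂
    have hsub : avoiding A S ⊆ avoiding A S₂ := fun x hx =>
      mem_avoiding.2 fun j hj => mem_avoiding.1 hx j (Finset.filter_subset _ _ hj)
    have h1 : (A i ∩ avoiding A S).card * P ≤ (avoiding A S₂).card :=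
      (Nat.mul_le_mul_right P (Finset.card_le_card (Finset.inter_subset_inter_left hsub))).trans
        (hind i S₂ fun j hj => (Finset.mem_filter.1 hj).2)
    by_cases hS : S.filter (R i) = ∅
    · have : S₂ = S := Finset.filter_true_of_mem fun j hj hR => by
        have : j ∈ S.filter (R i) := Finset.mem_filter.2 ⟨hj, hR⟩
        simp [hS] at this
      rw [this] at h1
      omega
    · have hlt : S₂ ⊂ S := by
        obtain ⟨j, hj⟩ := Finset.nonempty_iff_ne_empty.2 hS
        refine Finset.ssubset_iff_subset_ne.2 ⟨Finset.filter_subset _ _, fun h => ?_⟩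
        rw [Finset.mem_filter] at hj
        have := h ▸ hj.1
        exact (Finset.mem_filter.1 this).2 hj.2
      have hcov : avoiding A S₂ ⊆
          avoiding A S ∪ (S.filter (R i)).biUnion fun j => A j ∩ avoiding A S₂ := by
        intro x hx
        by_cases hxS : x ∈ avoiding A S
        · exact Finset.mem_union_left _ hxS
        · refine Finset.mem_union_right _ ?_
          rw [mem_avoiding] at hxS
          push Not at hxS
          obtain ⟨j, hj, hxj⟩ := hxS
          refine Finset.mem_biUnion.2 ⟨j, Finset.mem_filter.2 ⟨hj, ?_⟩,
            Finset.mem_inter.2 ⟨hxj, hx⟩⟩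
          by_contra hR
          exact mem_avoiding.1 hx j (Finset.mem_filter.2 ⟨hj, hR⟩) hxj
      have hsum : (∑ j ∈ S.filter (R i), (A j ∩ avoiding A S₂).card) * P
          ≤ D * (2 * (avoiding A S₂).card) := by
        rw [Finset.sum_mul]
        calc _ ≤ ∑ _j ∈ S.filter (R i), 2 * (avoiding A S₂).card :=
              Finset.sum_le_sum fun j _ => ih S₂ hlt j
          _ ≤ _ := by
              rw [Finset.sum_const, smul_eq_mul]
              exact Nat.mul_le_mul_right _ (hD i S)
      have hcard : (avoiding A S₂).card ≤
          (avoiding A S).card + ∑ j ∈ S.filter (R i), (A j ∩ avoiding A S₂).card :=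
        (Finset.card_le_card hcov).trans <| (Finset.card_union_le _ _).trans <|
          Nat.add_le_add_left Finset.card_biUnion_le _
      have hD1 : 1 ≤ D := (Finset.card_pos.2 (Finset.nonempty_iff_ne_empty.2 hS)).trans_le (hD i S)
      -- By induction each neighbouring event takes at most a fraction `2 / P` of `avoiding A S₂`.
      -- All of them together take at most `2 * D / P ≤ 1 / 2`, so at least half survives.
      have h2 : (avoiding A S₂).card ≤ 2 * (avoiding A S).card := by
        have h3 : (avoiding A S₂).card * P ≤
            (avoiding A S).card * P + D * (2 * (avoiding A S₂).card) := by
          calc _ ≤ _ := Nat.mul_le_mul_right P hcard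
            _ ≤ _ := by rw [add_mul]; omega
        have h4 : 4 * D * (avoiding A S₂).card ≤ P * (avoiding A S₂).card :=
          Nat.mul_le_mul_right _ hP
        have hP0 : 0 < P := by omega
        refine Nat.le_of_mul_le_mul_left ?_ hP0
        nlinarith
      omega

/-- The symmetric Lovász local lemma for uniformly random functions `V → α`: if each event `A i`
is determined by the coordinates in `T i`, has probability at most `1 / P`, and shares coordinates
with at most `D ≤ P / 4` of the events, then some function avoids all events. -/
theorem exists_avoiding_all {ι V α : Type*} [Fintype ι] [DecidableEq ι] [Fintype V]
    [DecidableEq V] [Fintype α] [DecidableEq α] [Nonempty α] (A : ι → Finset (V → α))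
    (T : ι → Finset V) (P D : ℕ)
    (hT : ∀ i, ∀ x y : V → α, (∀ v ∈ T i, x v = y v) → x ∈ A i → y ∈ A i)
    (hA : ∀ i, (A i).card * P ≤ Fintype.card (V → α))
    (hD : ∀ i, (Finset.univ.filter fun j => ¬ Disjoint (T i) (T j)).card ≤ D)
    (hP : 4 * D ≤ P) (hP3 : 3 ≤ P) : ∃ x, ∀ i, x ∉ A i := by
  have key := card_inter_avoiding_mul_le A (fun i j => ¬ Disjoint (T i) (T j)) P D
    (fun i S hS => by
      have h := card_inter_mul_card_le (T i) (A i) (avoiding A S) (hT i) (by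
        intro x y hxy hx
        rw [mem_avoiding] at hx ⊢
        intro j hj hy
        refine hx j hj (hT j y x (fun v hv => (hxy v fun hvi => ?_).symm) hy)
        exact Finset.disjoint_left.1 (not_not.1 (hS j hj)) hvi hv)
      refine Nat.le_of_mul_le_mul_right (c := Fintype.card (V → α)) ?_ Fintype.card_pos
      calc _ = ((A i ∩ avoiding A S).card * Fintype.card (V → α)) * P := by ring
        _ ≤ ((A i).card * (avoiding A S).card) * P := Nat.mul_le_mul_right _ h
        _ = ((A i).card * P) * (avoiding A S).card := by ring
        _ ≤ Fintype.card (V → α) * (avoiding A S).card := Nat.mul_le_mul_right _ (hA i)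
        _ = _ := by ring)
    (fun i S => (Finset.card_le_card
      (Finset.filter_subset_filter _ (Finset.subset_univ S))).trans (hD i)) hP
  have pos : ∀ S : Finset ι, 0 < (avoiding A S).card := by
    intro S
    induction S using Finset.induction_on with
    | empty => simpa [avoiding] using pow_pos (Fintype.card_pos (α := α)) (Fintype.card V)
    | insert i S _ ih =>
      have hcov : avoiding A S ⊆ avoiding A (insert i S) ∪ (A i ∩ avoiding A S) := by
        intro x hx
        by_cases hxi : x ∈ A i
        · exact Finset.mem_union_right _ (Finset.mem_inter.2 ⟨hxi, hx⟩)
        · refine Finset.mem_union_left _ (mem_avoiding.2 fun j hj => ?_)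
          rcases Finset.mem_insert.1 hj with rfl | hj
          · exact hxi
          · exact mem_avoiding.1 hx j hj
      have h1 := (Finset.card_le_card hcov).trans (Finset.card_union_le _ _)
      -- As `3 ≤ P`, the event `A i` fills at most two thirds of `avoiding A S`.
      have h2 := key S i
      by_contra h0
      have h3 : (avoiding A S).card ≤ (A i ∩ avoiding A S).card := by omega
      nlinarith
  obtain ⟨x, hx⟩ := Finset.card_pos.1 (pos Finset.univ)
  exact ⟨x, fun i => mem_avoiding.1 hx i (Finset.mem_univ i)⟩

/-- Prescribing `J.card` distinct coordinates of a function `V → α` has probability at most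
`(Fintype.card α) ^ (-J.card)`. -/
theorem card_filter_prescribed_mul_le {ι V α : Type*} [Fintype V] [DecidableEq V] [Fintype α]
    [DecidableEq α] (J : Finset ι) (w : ι → V) (hw : Set.InjOn w J) (a : ι → α) :
    (Finset.univ.filter fun x : V → α => ∀ i ∈ J, x (w i) = a i).card * Fintype.card α ^ J.card
      ≤ Fintype.card (V → α) := by
  classical
  have : Fintype.card α ^ J.card = Fintype.card (J → α) := by simp
  rw [this, ← Finset.card_univ, ← Finset.card_univ, ← Finset.card_product]
  -- Overwriting the prescribed coordinates by arbitrary values loses nothing: the old values are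
  -- known to be `a i`, and the new ones can be read off because `w` is injective on `J`.
  refine Finset.card_le_card_of_injOn
    (fun z v => if h : ∃ i : J, w i = v then z.2 h.choose else z.1 v) (fun _ _ => by simp) ?_
  have hch : ∀ (i : J) (h : ∃ i' : J, w i' = w i), h.choose = i := fun i h =>
    Subtype.ext (hw h.choose.2 i.2 h.choose_spec)
  rintro ⟨z, y⟩ hz ⟨z', y'⟩ hz' h
  simp only [Finset.coe_product, Set.mem_prod, Finset.mem_coe, Finset.mem_filter] at hz hz'
  refine Prod.ext (funext fun v => ?_) (funext fun i => ?_)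
  · by_cases hv : ∃ i : J, w i = v
    · obtain ⟨i, rfl⟩ := hv
      exact (hz.1.2 i i.2).trans (hz'.1.2 i i.2).symm
    · simpa [hv] using congrFun h v
  · have hi : ∃ i' : J, w i' = w i := ⟨i, rfl⟩
    have := congrFun h (w i)
    simp only [dif_pos hi, hch i hi] at this
    exact this

/-! ### Hubs of wheels and fans -/

/-- Every vertex lies in a cluster with a hub `h v`: edges stay inside clusters, hubs are adjacent
to the other vertices of their clusters, and each non-hub has at most two neighbours besides its
hub. -/
structure IsHubMap {V : Type} (G : SimpleGraph V) (h : V → V) : Prop where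
  eq_of_adj : ∀ u v, G.Adj u v → h u = h v
  adj_hub : ∀ v, h v ≠ v → G.Adj (h v) v
  ncard_le : ∀ v, h v ≠ v → {u | G.Adj v u ∧ u ≠ h v}.ncard ≤ 2

theorem IsHubMap.hub_hub {V : Type} {G : SimpleGraph V} {h : V → V} (hG : IsHubMap G h) (v : V) :
    h (h v) = h v := by
  by_cases hv : h v = v
  · rw [hv, hv]
  · exact hG.eq_of_adj _ _ (hG.adj_hub v hv)

theorem ncard_cycleGraph_neighbors_le (n : ℕ) (a : Fin n) :
    {b | (SimpleGraph.cycleGraph n).Adj a b}.ncard ≤ 2 := by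
  rcases n with _ | n
  · exact a.elim0
  · have : {b | (SimpleGraph.cycleGraph (n + 1)).Adj a b} ⊆ {a - 1, a + 1} := by
      intro b hb
      rcases n with _ | n
      · simp [SimpleGraph.cycleGraph_one_adj] at hb
      · rw [Set.mem_ofPred_eq, SimpleGraph.cycleGraph_adj] at hb
        rcases hb with hb | hb
        · left; rw [← hb]; abel
        · right; rw [Set.mem_singleton_iff, ← hb]; abel
    exact (Set.ncard_le_ncard this).trans ((Set.ncard_insert_le _ _).trans (by simp))

theorem exists_hub_of_iso_join {V : Type} {G : SimpleGraph V} (c : G.ConnectedComponent) {n : ℕ}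
    {H : SimpleGraph (Fin n)} (hH : ∀ a, {b | H.Adj a b}.ncard ≤ 2)
    (φ : c.toSimpleGraph ≃g graphJoin H (⊥ : SimpleGraph Unit)) :
    ∃ w, (∀ v ∈ c, v ≠ w → G.Adj w v) ∧
      ∀ v ∈ c, v ≠ w → {u | G.Adj v u ∧ u ≠ w}.ncard ≤ 2 := by
  have hinl : ∀ v (hv : v ∈ c), v ≠ (φ.symm (Sum.inr ())).1 → ∃ a, φ ⟨v, hv⟩ = Sum.inl a := by
    intro v hv hne
    rcases hφ : φ ⟨v, hv⟩ with a | ⟨⟩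
    · exact ⟨a, rfl⟩
    · exact absurd (by rw [← hφ, φ.symm_apply_apply]) hne
  refine ⟨(φ.symm (Sum.inr ())).1, fun v hv hne => ?_, fun v hv hne => ?_⟩
  · obtain ⟨a, ha⟩ := hinl v hv hne
    have : c.toSimpleGraph.Adj (φ.symm (Sum.inr ())) ⟨v, hv⟩ := by
      rw [← φ.map_adj_iff, φ.apply_symm_apply, ha]
      simp [graphJoin]
    exact (c.toSimpleGraph_adj _ hv).1 this
  · obtain ⟨a, ha⟩ := hinl v hv hne
    have : {u | G.Adj v u ∧ u ≠ (φ.symm (Sum.inr ())).1} ⊆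
        (fun b => (φ.symm (Sum.inl b)).1) '' {b | H.Adj a b} := by
      rintro u ⟨hvu, hu⟩
      have huc : u ∈ c := c.mem_supp_of_adj_mem_supp hv hvu
      obtain ⟨b, hb⟩ := hinl u huc hu
      refine ⟨b, ?_, by simp [← hb]⟩
      have : c.toSimpleGraph.Adj ⟨v, hv⟩ ⟨u, huc⟩ := (c.toSimpleGraph_adj hv huc).2 hvu
      rw [← φ.map_adj_iff, ha, hb] at this
      simpa [graphJoin] using this
    exact (Set.ncard_le_ncard this (Set.toFinite _)).trans
      ((Set.ncard_image_le (Set.toFinite _)).trans (hH a))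

theorem exists_isHubMap {V : Type} {G : SimpleGraph V} (hG : wheelFanClass G) :
    ∃ h, IsHubMap G h := by
  have : ∀ c : G.ConnectedComponent, ∃ w, (∀ v ∈ c, v ≠ w → G.Adj w v) ∧
      ∀ v ∈ c, v ≠ w → {u | G.Adj v u ∧ u ≠ w}.ncard ≤ 2 := by
    intro c
    rcases hG c with ⟨n, -, ⟨φ⟩⟩ | ⟨n, -, ⟨φ⟩⟩
    · exact exists_hub_of_iso_join c (ncard_cycleGraph_neighbors_le n) φ
    · refine exists_hub_of_iso_join c (fun a => ?_) φ
      exact (Set.ncard_le_ncard fun b hb => SimpleGraph.pathGraph_le_cycleGraph hb).trans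
        (ncard_cycleGraph_neighbors_le n a)
  choose w hw using this
  refine ⟨fun v => w (G.connectedComponentMk v), ⟨fun u v huv => ?_, fun v hv => ?_, fun v hv => ?_⟩⟩
  · exact congrArg w (SimpleGraph.ConnectedComponent.sound huv.reachable)
  · exact (hw _).1 v rfl hv.symm
  · exact (hw _).2 v rfl hv.symm

/-! ### Upper bound: random claims and list coloring -/

theorem exists_injective_fin_of_le_card {α : Type*} {k : ℕ} {s : Finset α} (h : k ≤ s.card) :
    ∃ f : Fin k → α, Function.Injective f ∧ ∀ a, f a ∈ s :=
  ⟨fun a => (s.equivFin.symm (Fin.castLE h a)).1,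
    fun _ _ hab => Fin.castLE_injective h (s.equivFin.symm.injective (Subtype.ext hab)),
    fun a => (s.equivFin.symm (Fin.castLE h a)).2⟩

/-- List colouring against color-dependent conflicts: lists of `32` colors suffice if, for every
color, each vertex conflicts with at most two vertices. -/
theorem exists_list_coloring {V : Type*} [Fintype V] {m : ℕ} (R : Fin m → V → V → Prop)
    (hsymm : ∀ i u v, R i u v → R i v u) (hne : ∀ i u v, R i u v → u ≠ v)
    (hdeg : ∀ i v, {u | R i v u}.ncard ≤ 2) (g : V → Fin 32 → Fin m)
    (hg : ∀ i u v, R i u v → Function.Injective (g u)) :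
    ∃ y : V → Fin 32, ∀ i u v, R i u v → ¬ (g u (y u) = i ∧ g v (y v) = i) := by
  classical
  -- Only conflicts whose color is in both lists can occur. The other triples get an empty event and
  -- empty support, so that they create no dependencies.
  let valid : Fin m × V × V → Prop := fun q =>
    R q.1 q.2.1 q.2.2 ∧ (∃ a, g q.2.1 a = q.1) ∧ ∃ b, g q.2.2 b = q.1
  let N : Fin m → V → Finset V := fun i v => Finset.univ.filter fun u => R i v u
  have hN : ∀ i v, (N i v).card ≤ 2 := by
    intro i v
    rw [← Set.ncard_coe_finset]
    simpa [N] using hdeg i v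
  -- `Q w` contains all valid triples through `w`: 32 colors, at most two conflicting vertices for
  -- each, and two orders, hence at most 128.
  let Q : V → Finset (Fin m × V × V) := fun w => Finset.univ.biUnion fun a =>
    (N (g w a) w).image (fun v => (g w a, w, v)) ∪ (N (g w a) w).image (fun u => (g w a, u, w))
  have hQ : ∀ w, (Q w).card ≤ 128 := by
    intro w
    refine Finset.card_biUnion_le.trans ?_
    calc _ ≤ ∑ _a : Fin 32, 4 := Finset.sum_le_sum fun a _ => by
          refine (Finset.card_union_le _ _).trans ?_
          have h1 := (Finset.card_image_le (s := N (g w a) w)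
            (f := fun v => (g w a, w, v))).trans (hN _ _)
          have h2 := (Finset.card_image_le (s := N (g w a) w)
            (f := fun u => (g w a, u, w))).trans (hN _ _)
          omega
      _ = 128 := by simp
  obtain ⟨y, hy⟩ := exists_avoiding_all (ι := Fin m × V × V)
    (fun q => Finset.univ.filter fun y : V → Fin 32 =>
      valid q ∧ g q.2.1 (y q.2.1) = q.1 ∧ g q.2.2 (y q.2.2) = q.1)
    -- Two list entries are prescribed, whence `1024 = 32 ^ 2`; a triple meets at most `128 + 128 =
    -- 256` others, and `4 * 256 = 1024`.
    (fun q => if valid q then {q.2.1, q.2.2} else ∅) 1024 256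
    (by
      intro q x y hxy hx
      simp only [Finset.mem_filter, Finset.mem_univ, true_and] at hx ⊢
      obtain ⟨hv, h1, h2⟩ := hx
      rw [if_pos hv] at hxy
      rw [← hxy q.2.1 (by simp), ← hxy q.2.2 (by simp)]
      exact ⟨hv, h1, h2⟩)
    (by
      rintro ⟨i, u, v⟩
      by_cases hv : valid (i, u, v)
      · obtain ⟨hR, ⟨a, ha⟩, ⟨b, hb⟩⟩ := id hv
        dsimp only at hR ha hb
        have hinj : Set.InjOn (fun t : Bool => bif t then u else v)
            ((Finset.univ : Finset Bool) : Set Bool) := by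
          have := hne i u v hR
          intro s _ t _ hst
          cases s <;> cases t <;> simp_all
        have h := card_filter_prescribed_mul_le Finset.univ _ hinj
          (fun t : Bool => bif t then a else b)
        refine le_trans ?_ h
        rw [show (1024 : ℕ) = Fintype.card (Fin 32) ^ (Finset.univ : Finset Bool).card by simp]
        refine Nat.mul_le_mul_right _ (Finset.card_le_card fun y hy => ?_)
        simp only [Finset.mem_filter, Finset.mem_univ, true_and, Bool.forall_bool, cond_false,
          cond_true, forall_const] at hy ⊢
        exact ⟨hg i v u (hsymm _ _ _ hR) (hy.2.2.trans hb.symm),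
          hg i u v hR (hy.2.1.trans ha.symm)⟩
      · simp [hv])
    (by
      rintro ⟨i, u, v⟩
      have hsub : (Finset.univ.filter fun q : Fin m × V × V =>
          ¬ Disjoint (if valid (i, u, v) then ({u, v} : Finset V) else ∅)
            (if valid q then {q.2.1, q.2.2} else ∅)) ⊆ Q u ∪ Q v := by
        have hmem : ∀ (q : Fin m × V × V) (w : V), valid q → w = q.2.1 ∨ w = q.2.2 → q ∈ Q w := by
          rintro ⟨j, s, t⟩ w ⟨hR, ⟨a, ha⟩, ⟨b, hb⟩⟩ hw
          dsimp only at hR ha hb hw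
          rcases hw with rfl | rfl
          · subst ha
            exact Finset.mem_biUnion.2 ⟨a, Finset.mem_univ _, Finset.mem_union_left _
              (Finset.mem_image.2 ⟨t, by simpa [N] using hR, rfl⟩)⟩
          · subst hb
            exact Finset.mem_biUnion.2 ⟨b, Finset.mem_univ _, Finset.mem_union_right _
              (Finset.mem_image.2 ⟨s, by simpa [N] using hsymm _ _ _ hR, rfl⟩)⟩
        intro q hq
        simp only [Finset.mem_filter, Finset.mem_univ, true_and] at hq
        rw [Finset.not_disjoint_iff] at hq
        obtain ⟨w, hw1, hw2⟩ := hq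
        split_ifs at hw1 hw2 with h1 h2
        · have hqw := hmem q w h2 (by simpa using hw2)
          simp only [Finset.mem_insert, Finset.mem_singleton] at hw1
          rcases hw1 with rfl | rfl
          · exact Finset.mem_union_left _ hqw
          · exact Finset.mem_union_right _ hqw
        all_goals simp at hw1 hw2
      refine (Finset.card_le_card hsub).trans ((Finset.card_union_le _ _).trans ?_)
      have := hQ u
      have := hQ v
      omega)
    (by norm_num) (by norm_num)
  refine ⟨y, fun i u v hR hc => hy (i, u, v) ?_⟩
  simp only [Finset.mem_filter, Finset.mem_univ, true_and]
  exact ⟨⟨hR, ⟨_, hc.1⟩, ⟨_, hc.2⟩⟩, hc⟩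

/-- Vertices that are hubs for at least `k` colors can each claim one of these colors so that
every other vertex has at least `s` colors in which its hub is another vertex that does not claim
the color. -/
theorem exists_claims {V : Type*} [Fintype V] [DecidableEq V] {m d k r s : ℕ}
    (h : Fin m → V → V)
    (hd : ∀ i w, (Finset.univ.filter fun u => h i u = w ∧ u ≠ w).card ≤ d)
    (e : V → Fin k → Fin m)
    (he : ∀ v, k ≤ (Finset.univ.filter fun i => h i v = v).card → Function.Injective (e v))
    (hk : 0 < k) (hd0 : 0 < d) (hr : r + k + s ≤ m) (hm : 2 ^ m * (4 * (m * m * d)) ≤ k ^ r) :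
    ∃ x : V → Fin k, ∀ v, (Finset.univ.filter fun i => h i v = v).card < k →
      s ≤ (Finset.univ.filter fun i => h i v ≠ v ∧
        ¬ (k ≤ (Finset.univ.filter fun j => h j (h i v) = h i v).card ∧
          e (h i v) (x (h i v)) = i)).card := by
  set C : V → Finset (Fin m) := fun v => Finset.univ.filter fun i => h i v = v with hC
  set F : (V → Fin k) → V → Finset (Fin m) := fun x v => Finset.univ.filter fun i => h i v ≠ v ∧
    ¬ (k ≤ (C (h i v)).card ∧ e (h i v) (x (h i v)) = i) with hF
  change ∃ x : V → Fin k, ∀ v, (C v).card < k → s ≤ (F x v).card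
  have hm0 : 0 < m := by omega
  have : Nonempty (Fin k) := ⟨⟨0, hk⟩⟩
  obtain ⟨x, hx⟩ := exists_avoiding_all (ι := V)
    (fun v => Finset.univ.filter fun x : V → Fin k => (C v).card < k ∧ (F x v).card < s)
    (fun v => (Finset.univ.filter fun i => h i v ≠ v).image fun i => h i v)
    (4 * (m * m * d)) (m * m * d)
    (by
      intro v x y hxy hx
      simp only [Finset.mem_filter, Finset.mem_univ, true_and] at hx ⊢
      have : F y v = F x v := by
        refine Finset.filter_congr fun i _ => and_congr_right fun hi => ?_
        rw [hxy (h i v) (Finset.mem_image.2 ⟨i, by simpa using hi, rfl⟩)]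
      rw [this]
      exact hx)
    (by
      intro v
      -- `B J`: for every color in `J`, the hub of `v` claims exactly that color.
      let B : Finset (Fin m) → Finset (V → Fin k) := fun J => Finset.univ.filter fun x =>
        ∀ i ∈ J, k ≤ (C (h i v)).card ∧ e (h i v) (x (h i v)) = i
      have hB : ∀ J : Finset (Fin m), (B J).card * k ^ J.card ≤ Fintype.card (V → Fin k) := by
        intro J
        -- A single outcome `x₀` in `B J` shows that the hubs over `J` are distinct and fixes the
        -- values that every other outcome must take there.
        rcases (B J).eq_empty_or_nonempty with h0 | ⟨x₀, hx₀⟩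
        · simp [h0]
        · simp only [B, Finset.mem_filter, Finset.mem_univ, true_and] at hx₀
          have hinj : Set.InjOn (fun i => h i v) (J : Set (Fin m)) := by
            intro i hi j hj hij
            dsimp only at hij
            rw [← (hx₀ i hi).2, ← (hx₀ j hj).2, hij]
          have := card_filter_prescribed_mul_le J _ hinj (fun i => x₀ (h i v))
          rw [Fintype.card_fin] at this
          refine le_trans (Nat.mul_le_mul_right _ (Finset.card_le_card fun x hx => ?_)) this
          simp only [B, Finset.mem_filter, Finset.mem_univ, true_and] at hx ⊢
          exact fun i hi => he _ (hx i hi).1 ((hx i hi).2.trans (hx₀ i hi).2.symm)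
      have hcov : (Finset.univ.filter fun x : V → Fin k => (C v).card < k ∧ (F x v).card < s) ⊆
          (Finset.powersetCard r Finset.univ).biUnion B := by
        intro x hx
        simp only [Finset.mem_filter, Finset.mem_univ, true_and] at hx
        -- Colors outside `C v` and `F x v` are those claimed by the hub of `v`; at least `m - k - s
        -- ≥ r` of them remain.
        have hcard : r ≤ (Finset.univ \ (C v ∪ F x v)).card := by
          have h1 := Finset.card_union_le (C v) (F x v)
          rw [Finset.card_sdiff_of_subset (Finset.subset_univ _), Finset.card_univ,
            Fintype.card_fin]
          omega
        obtain ⟨J, hJ, hJr⟩ := Finset.exists_subset_card_eq hcard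
        refine Finset.mem_biUnion.2 ⟨J, Finset.mem_powersetCard.2 ⟨Finset.subset_univ _, hJr⟩, ?_⟩
        simp only [B, Finset.mem_filter, Finset.mem_univ, true_and]
        intro i hi
        have := hJ hi
        simp only [hC, hF, Finset.mem_sdiff, Finset.mem_univ, true_and, Finset.mem_union,
          Finset.mem_filter, not_or, not_and] at this
        by_contra hc
        exact this.2 this.1 fun h1 h2 => hc ⟨h1, h2⟩
      have hkr : 0 < k ^ r := pow_pos hk r
      refine Nat.le_of_mul_le_mul_right (c := k ^ r) ?_ hkr
      have hsum : (Finset.univ.filter fun x : V → Fin k =>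
          (C v).card < k ∧ (F x v).card < s).card * k ^ r ≤ 2 ^ m * Fintype.card (V → Fin k) := by
        calc _ ≤ (∑ J ∈ Finset.powersetCard r Finset.univ, (B J).card) * k ^ r :=
              Nat.mul_le_mul_right _ ((Finset.card_le_card hcov).trans Finset.card_biUnion_le)
          _ = ∑ J ∈ Finset.powersetCard r Finset.univ, (B J).card * k ^ r := Finset.sum_mul ..
          _ ≤ ∑ J ∈ Finset.powersetCard r (Finset.univ : Finset (Fin m)),
                Fintype.card (V → Fin k) := Finset.sum_le_sum fun J hJ => by
              have := hB J
              rwa [(Finset.mem_powersetCard.1 hJ).2] at this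
          _ ≤ _ := by
              rw [Finset.sum_const, smul_eq_mul]
              refine Nat.mul_le_mul_right _ ?_
              calc _ ≤ (Finset.univ : Finset (Finset (Fin m))).card :=
                    Finset.card_le_card (Finset.subset_univ _)
                _ = 2 ^ m := by simp
      calc _ = (Finset.univ.filter fun x : V → Fin k =>
            (C v).card < k ∧ (F x v).card < s).card * k ^ r * (4 * (m * m * d)) := by ring
        _ ≤ 2 ^ m * Fintype.card (V → Fin k) * (4 * (m * m * d)) := Nat.mul_le_mul_right _ hsum
        _ = Fintype.card (V → Fin k) * (2 ^ m * (4 * (m * m * d))) := by ring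
        _ ≤ _ := Nat.mul_le_mul_left _ hm)
    (by
      intro v
      -- Events of `u` and `v` are dependent only if `u` hangs from some hub of `v`: `m * m` pairs
      -- of colors, at most `d` vertices for each.
      have hsub : (Finset.univ.filter fun u =>
          ¬ Disjoint ((Finset.univ.filter fun i => h i v ≠ v).image fun i => h i v)
            ((Finset.univ.filter fun i => h i u ≠ u).image fun i => h i u)) ⊆
          Finset.univ.biUnion fun p : Fin m × Fin m =>
            Finset.univ.filter fun u => h p.2 u = h p.1 v ∧ u ≠ h p.1 v := by
        intro u hu
        simp only [Finset.mem_filter, Finset.mem_univ, true_and] at hu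
        rw [Finset.not_disjoint_iff] at hu
        obtain ⟨w, hw1, hw2⟩ := hu
        simp only [Finset.mem_image, Finset.mem_filter, Finset.mem_univ, true_and] at hw1 hw2
        obtain ⟨i, hi, rfl⟩ := hw1
        obtain ⟨j, hj, hji⟩ := hw2
        refine Finset.mem_biUnion.2 ⟨(i, j), Finset.mem_univ _, ?_⟩
        simp only [Finset.mem_filter, Finset.mem_univ, true_and]
        exact ⟨hji, fun h0 => hj (hji.trans h0.symm)⟩
      refine (Finset.card_le_card hsub).trans (Finset.card_biUnion_le.trans ?_)
      calc _ ≤ ∑ _p : Fin m × Fin m, d := Finset.sum_le_sum fun p _ => hd p.2 (h p.1 v)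
        _ = m * m * d := by simp)
    le_rfl
    (by
      have : 0 < m * m * d := by positivity
      omega)
  refine ⟨x, fun v hv => ?_⟩
  have := hx v
  simp only [Finset.mem_filter, Finset.mem_univ, true_and, not_and, not_lt] at this
  exact this hv

/-- Big vertices take their claimed color, small ones a color from their list. A monochromatic edge
has a common hub. Two big ends would both be this hub; a big end would be the hub claiming the small
end's color; two small ends are both non-hubs, which the list coloring excludes. -/
theorem mem_cooperativeNumbers_of_le {m d k r : ℕ} (hk : 0 < k) (hd0 : 0 < d)
    (hr : r + k + 32 ≤ m) (hm : 2 ^ m * (4 * (m * m * d)) ≤ k ^ r) :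
    m ∈ cooperativeNumbers wheelFanClass d := by
  classical
  intro V _ G _ hG hdeg
  choose h hh using fun i => exists_isHubMap (hG i)
  have hm0 : 0 < m := by omega
  have hd : ∀ i w, (Finset.univ.filter fun u => h i u = w ∧ u ≠ w).card ≤ d := by
    intro i w
    refine (Finset.card_le_card fun u hu => ?_).trans
      (((G i).degree_le_maxDegree w).trans (hdeg i))
    simp only [Finset.mem_filter, Finset.mem_univ, true_and] at hu
    rw [SimpleGraph.mem_neighborFinset]
    obtain ⟨rfl, hu⟩ := hu
    exact (hh i).adj_hub u hu.symm
  let C : V → Finset (Fin m) := fun v => Finset.univ.filter fun i => h i v = v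
  have hE : ∀ v, ∃ f : Fin k → Fin m, k ≤ (C v).card →
      Function.Injective f ∧ ∀ a, f a ∈ C v := by
    intro v
    by_cases hv : k ≤ (C v).card
    · obtain ⟨f, hf⟩ := exists_injective_fin_of_le_card hv
      exact ⟨f, fun _ => hf⟩
    · exact ⟨fun _ => ⟨0, hm0⟩, fun h0 => absurd h0 hv⟩
  choose e he using hE
  obtain ⟨x, hx⟩ := exists_claims h hd e (fun v hv => (he v hv).1) hk hd0 hr hm
  let F : V → Finset (Fin m) := fun v => Finset.univ.filter fun i => h i v ≠ v ∧
    ¬ (k ≤ (C (h i v)).card ∧ e (h i v) (x (h i v)) = i)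
  have hE' : ∀ v, ∃ f : Fin 32 → Fin m, (C v).card < k →
      Function.Injective f ∧ ∀ a, f a ∈ F v := by
    intro v
    by_cases hv : (C v).card < k
    · obtain ⟨f, hf⟩ := exists_injective_fin_of_le_card (hx v hv)
      exact ⟨f, fun _ => hf⟩
    · exact ⟨fun _ => ⟨0, hm0⟩, fun h0 => absurd h0 hv⟩
  choose g hg using hE'
  obtain ⟨y, hy⟩ := exists_list_coloring
    -- Restricting the conflicts to non-hubs discards hub edges, so at most two conflicts per vertex
    -- and color are left.
    (fun i u v => (G i).Adj u v ∧ ((C u).card < k ∧ h i u ≠ u) ∧ ((C v).card < k ∧ h i v ≠ v))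
    (fun i u v huv => ⟨huv.1.symm, huv.2.2, huv.2.1⟩) (fun i u v huv => huv.1.ne)
    (fun i v => by
      by_cases hv : h i v = v
      · simp [hv]
      · refine (Set.ncard_le_ncard (fun u hu => ?_) (Set.toFinite _)).trans ((hh i).ncard_le v hv)
        refine ⟨hu.1, ?_⟩
        rintro rfl
        exact hu.2.2.2 ((hh i).hub_hub v))
    g (fun i u v huv => (hg u huv.2.1.1).1)
  let col : V → Fin m := fun v => if k ≤ (C v).card then e v (x v) else g v (y v)
  have hcol1 : ∀ v, k ≤ (C v).card → h (col v) v = v := by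
    intro v hv
    have := (he v hv).2 (x v)
    simp only [col, if_pos hv]
    simpa [C] using this
  have hcol2 : ∀ v, (C v).card < k → col v ∈ F v := by
    intro v hv
    simp only [col, if_neg hv.not_ge]
    exact (hg v hv).2 _
  have hbig : ∀ u v, k ≤ (C u).card → (G (col u)).Adj u v → col v ≠ col u := by
    intro u v hu huv hc
    have h1 := hcol1 u hu
    have h2 := (hh (col u)).eq_of_adj u v huv
    by_cases hv : k ≤ (C v).card
    · have h3 := hcol1 v hv
      rw [hc] at h3
      exact huv.ne (h1.symm.trans (h2.trans h3))
    · have h4 := hcol2 v (not_le.1 hv)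
      simp only [F, Finset.mem_filter, Finset.mem_univ, true_and, hc] at h4
      rw [← h2, h1] at h4
      refine h4.2 ⟨hu, ?_⟩
      simp only [col, if_pos hu]
  refine ⟨fun i => {v | col v = i}, fun i => ?_, ?_⟩
  · rintro u rfl v hv - huv
    have hv' : col v = col u := hv
    by_cases hu : k ≤ (C u).card
    · exact hbig u v hu huv hv'
    by_cases hv2 : k ≤ (C v).card
    · exact hbig v u hv2 (hv' ▸ huv.symm) hv'.symm
    have h1 := hcol2 u (not_le.1 hu)
    have h2 := hcol2 v (not_le.1 hv2)
    rw [hv'] at h2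
    simp only [F, Finset.mem_filter, Finset.mem_univ, true_and] at h1 h2
    refine hy (col u) u v ⟨huv, ⟨not_le.1 hu, h1.1⟩, ⟨not_le.1 hv2, h2.1⟩⟩ ⟨?_, ?_⟩
    · simp only [col, if_neg hu]
    · rw [← hv']
      simp only [col, if_neg hv2]
  · ext v
    simp

/-! ### Lower bound: duplicate-free lists of colors -/

/-- Any partition of a finite set into clusters of size at least two, each with a distinguished
hub, is realised by a graph whose components are fans with these hubs. -/
theorem exists_wheelFanClass_of_hub {V : Type} [Fintype V] (h : V → V)
    (hh : ∀ v, h (h v) = h v) (hne : ∀ v, ∃ u, u ≠ h v ∧ h u = h v) :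
    ∃ G : SimpleGraph V, wheelFanClass G ∧ ∀ v, h v ≠ v → G.Adj (h v) v := by
  classical
  let p : V → {w // h w = w} := fun v => ⟨h v, hh v⟩
  have hp : ∀ w : {w // h w = w}, p w.1 = w := fun w => Subtype.ext w.2
  have hφ : ∀ w : {w // h w = w}, ∃ n, 1 ≤ n ∧ ∃ φ : {v // p v = w} ≃ Fin n ⊕ Unit,
      φ ⟨w.1, hp w⟩ = Sum.inr () := by
    intro w
    obtain ⟨u, hu, huw⟩ := hne w.1
    rw [w.2] at hu huw
    have hcard : 1 < Fintype.card {v // p v = w} :=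
      Fintype.one_lt_card_iff.2 ⟨⟨u, Subtype.ext huw⟩, ⟨w.1, hp w⟩, fun h0 =>
        hu (congrArg Subtype.val h0)⟩
    -- The order along the path is irrelevant, so any bijection serves once a swap sends the hub to
    -- the apex. Clusters of size at least two make the path nonempty.
    let e : {v // p v = w} ≃ Fin (Fintype.card {v // p v = w} - 1) ⊕ Unit :=
      Fintype.equivOfCardEq (by simp; omega)
    exact ⟨_, by omega, e.trans (Equiv.swap (e ⟨w.1, hp w⟩) (Sum.inr ())), by simp⟩
  choose n hn φ hφ using hφ
  let G : SimpleGraph V :=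
    { Adj := fun u v => ∃ (w : {w // h w = w}) (hu : p u = w) (hv : p v = w),
        (fanGraph (n w)).Adj (φ w ⟨u, hu⟩) (φ w ⟨v, hv⟩)
      symm := ⟨fun u v ⟨w, hu, hv, huv⟩ => ⟨w, hv, hu, huv.symm⟩⟩
      loopless := ⟨fun u ⟨w, hu, hv, huv⟩ => huv.ne rfl⟩ }
  have hadj : ∀ v (w : {w // h w = w}), p v = w → w.1 ≠ v → G.Adj w.1 v := by
    intro v w hv hwv
    refine ⟨w, hp w, hv, ?_⟩
    rw [hφ]
    rcases hx : φ w ⟨v, hv⟩ with a | ⟨⟩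
    · simp [fanGraph, graphJoin]
    · exact absurd (congrArg Subtype.val ((φ w).injective (hx.trans (hφ w).symm))).symm hwv
  refine ⟨G, fun c => Or.inr ?_, fun v hv => hadj v (p v) rfl hv⟩
  induction c using SimpleGraph.ConnectedComponent.ind with
  | h v =>
    have hsupp : ∀ u, u ∈ G.connectedComponentMk v ↔ p u = p v := by
      intro u
      change G.connectedComponentMk u = G.connectedComponentMk v ↔ _
      rw [SimpleGraph.ConnectedComponent.eq]
      have hub : ∀ u, G.Reachable (p u).1 u := by
        intro u
        by_cases hu : (p u).1 = u
        · rw [hu]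
        · exact (hadj u (p u) rfl hu).reachable
      constructor
      · rintro ⟨q⟩
        induction q with
        | nil => rfl
        | cons huv _ ih =>
          obtain ⟨w, h1, h2, -⟩ := huv
          exact h1.trans (h2.symm.trans ih)
      · intro hu
        have := hub u
        rw [hu] at this
        exact this.symm.trans (hub v)
    refine ⟨n (p v), hn _, ⟨⟨(Equiv.subtypeEquivRight hsupp).trans (φ (p v)), ?_⟩⟩⟩
    rintro ⟨a, ha⟩ ⟨b, hb⟩
    rw [SimpleGraph.ConnectedComponent.toSimpleGraph_adj _ ha hb]
    constructor
    · exact fun hab => ⟨p v, (hsupp a).1 ha, (hsupp b).1 hb, hab⟩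
    · rintro ⟨w, h1, h2, hab⟩
      obtain rfl : w = p v := h1.symm.trans ((hsupp a).1 ha)
      exact hab

theorem card_nodup_list_le (m : ℕ) :
    Fintype.card {l : List (Fin m) // l.Nodup} ≤ (m + 1) ^ m := by
  have : Fintype.card (Fin m → Option (Fin m)) = (m + 1) ^ m := by simp
  rw [← this]
  -- A list is encoded by its first `m` entries, padded by `none`; duplicate-free lists are no
  -- longer than that.
  refine Fintype.card_le_of_injective (fun l i => l.1[i.1]?) ?_
  rintro ⟨l, hl⟩ ⟨l', hl'⟩ hll
  refine Subtype.ext (List.ext_getElem? fun i => ?_)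
  by_cases hi : i < m
  · exact congrFun hll ⟨i, hi⟩
  · have h1 := hl.length_le_card
    have h2 := hl'.length_le_card
    rw [Fintype.card_fin] at h1 h2
    dsimp only
    rw [List.getElem?_eq_none (by omega), List.getElem?_eq_none (by omega)]

theorem List.takeWhile_ne_append_of_mem {α : Type*} [DecidableEq α] {c : α} {l l' : List α}
    (h : c ∈ l) : (l ++ l').takeWhile (· ≠ c) = l.takeWhile (· ≠ c) := by
  induction l with
  | nil => simp at h
  | cons a l ih =>
    by_cases ha : a = c
    · simp [ha]
    · have : c ∈ l := (List.mem_cons.1 h).resolve_left (Ne.symm ha)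
      simpa [ha] using ih this

theorem List.takeWhile_ne_of_notMem {α : Type*} [DecidableEq α] {c : α} {l : List α}
    (h : c ∉ l) : l.takeWhile (· ≠ c) = l :=
  List.takeWhile_eq_self_iff.2 fun x hx => by
    rw [decide_eq_true_iff]
    rintro rfl
    exact h hx

theorem List.notMem_takeWhile_ne {α : Type*} [DecidableEq α] (c : α) (l : List α) :
    c ∉ l.takeWhile (· ≠ c) := fun h => by
  simpa using List.mem_takeWhile_imp h

theorem notMem_cooperativeNumbers_of_le {m d : ℕ} (hd : (m + 1) ^ m ≤ d) :
    m ∉ cooperativeNumbers wheelFanClass d := by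
  classical
  intro hmem
  let h : Fin m → {l : List (Fin m) // l.Nodup} → {l : List (Fin m) // l.Nodup} := fun c l =>
    ⟨l.1.takeWhile (· ≠ c), l.2.sublist (List.takeWhile_prefix _).sublist⟩
  have happ : ∀ (l : {l : List (Fin m) // l.Nodup}) (c), c ∉ l.1 → (l.1 ++ [c]).Nodup := by
    intro l c hc
    rw [← List.concat_eq_append]
    exact l.2.concat hc
  have hself : ∀ l : List (Fin m), ∀ c, c ∉ l → (l ++ [c]).takeWhile (· ≠ c) = l := by
    intro l c hc
    rw [List.takeWhile_append_of_pos]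
    · simp
    · intro x hx
      rw [decide_eq_true_iff]
      rintro rfl
      exact hc hx
  have hG : ∀ c, ∃ G : SimpleGraph {l : List (Fin m) // l.Nodup}, wheelFanClass G ∧
      ∀ v, h c v ≠ v → G.Adj (h c v) v := by
    refine fun c => exists_wheelFanClass_of_hub (h c) (fun l => Subtype.ext ?_) fun l => ?_
    · exact List.takeWhile_ne_of_notMem (List.notMem_takeWhile_ne c l.1)
    -- If `l` avoids `c`, then appending `c` gives a second member of its cluster; otherwise `l`
    -- itself is a non-hub member.
    · by_cases hl : h c l = l
      · have hc : c ∉ l.1 := by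
          rw [← hl]
          exact List.notMem_takeWhile_ne c l.1
        rw [hl]
        refine ⟨⟨l.1 ++ [c], happ l c hc⟩, fun h0 => ?_, Subtype.ext (hself l.1 c hc)⟩
        have := congrArg (fun l => l.1.length) h0
        simp at this
      · exact ⟨l, Ne.symm hl, rfl⟩
  choose G hG hadj using hG
  obtain ⟨I, hI, hcov⟩ := hmem _ G hG fun c => by
    have : Nonempty {l : List (Fin m) // l.Nodup} := ⟨⟨[], List.nodup_nil⟩⟩
    exact ((G c).maxDegree_lt_card_verts.le.trans (card_nodup_list_le m)).trans hd
  have hf : ∀ l, ∃ c, l ∈ I c := fun l => by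
    simpa using Set.ext_iff.1 hcov l
  choose f hf using hf
  -- Invariant: for each color `c` in `l`, the part of `l` before `c` has color `c`. This part is
  -- adjacent to `l` in color `c`, so the color of `l` is not in `l` and can be appended.
  have hpath : ∀ t : ℕ, ∃ l : {l : List (Fin m) // l.Nodup}, l.1.length = t ∧
      ∀ c ∈ l.1, f (h c l) = c := by
    intro t
    induction t with
    | zero => exact ⟨⟨[], List.nodup_nil⟩, rfl, by simp⟩
    | succ t ih =>
      obtain ⟨l, hlt, hl⟩ := ih
      have hc : f l ∉ l.1 := by
        intro hc
        have hne : h (f l) l ≠ l := by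
          intro h0
          have : l.1.takeWhile (· ≠ f l) = l.1 := congrArg Subtype.val h0
          exact List.notMem_takeWhile_ne (f l) l.1 (by rw [this]; exact hc)
        have h1 : h (f l) l ∈ I (f l) := by
          have := hf (h (f l) l)
          rwa [hl _ hc] at this
        exact hI (f l) h1 (hf l) hne (hadj _ _ hne)
      refine ⟨⟨l.1 ++ [f l], happ l _ hc⟩, by simp [hlt], fun c hcl => ?_⟩
      rcases List.mem_append.1 hcl with hcl | hcl
      · have : h c ⟨l.1 ++ [f l], happ l _ hc⟩ = h c l :=
          Subtype.ext (List.takeWhile_ne_append_of_mem hcl)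
        rw [this, hl c hcl]
      · obtain rfl := List.mem_singleton.1 hcl
        have : h (f l) ⟨l.1 ++ [f l], happ l _ hc⟩ = l := Subtype.ext (hself l.1 _ hc)
        rw [this]
  obtain ⟨l, hl, -⟩ := hpath (m + 1)
  have := l.2.length_le_card
  rw [hl, Fintype.card_fin] at this
  omega

/-! ### Asymptotics -/

theorem cooperativeNumbers_upward_closed {𝒢 : GraphClass} {d m m' : ℕ}
    (hm : m ∈ cooperativeNumbers 𝒢 d) (hmm : m ≤ m') : m' ∈ cooperativeNumbers 𝒢 d := by
  intro V _ G _ hG hdeg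
  obtain ⟨I, hI, hcov⟩ := hm V (fun i => G (Fin.castLE hmm i)) (fun i => hG _) (fun i => hdeg _)
  -- The surplus colors receive the empty set.
  refine ⟨fun j => {v | ∃ h : j.1 < m, v ∈ I ⟨j.1, h⟩}, ?_, ?_⟩
  · rintro j u ⟨h, hu⟩ v ⟨_, hv⟩ huv
    exact hI ⟨j.1, h⟩ hu hv huv
  · refine Set.eq_univ_of_forall fun v => ?_
    obtain ⟨i, hi⟩ := Set.mem_iUnion.1 (hcov ▸ Set.mem_univ v)
    exact Set.mem_iUnion.2 ⟨Fin.castLE hmm i, i.2, hi⟩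

/-- `m` colors suffice as soon as `log d ≤ (1 - δ) m log m` and `m` is large. -/
theorem eventually_mem_cooperativeNumbers {δ : ℝ} (hδ : 0 < δ) :
    ∀ᶠ m : ℕ in atTop, ∀ d : ℕ, 0 < d → Real.log d ≤ (1 - δ) * (m * Real.log m) →
      m ∈ cooperativeNumbers wheelFanClass d := by
  -- With `k` about `m / q`, the exponent `r` loses a fraction `1 / q < δ`; the slack `η = δ - 1 /
  -- q` absorbs the lower-order terms. The bound `1 / 2` ensures `k + 32 ≤ m`.
  obtain ⟨q', hq'⟩ := exists_nat_one_div_lt (show 0 < min δ (1 / 2) by positivity)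
  set q : ℕ := q' + 1 with hq
  have hqδ : 1 / (q : ℝ) < δ := by
    have := hq'.trans_le (min_le_left _ _)
    rw [hq]; push_cast; exact this
  have hq2 : 1 / (q : ℝ) < 1 / 2 := by
    have := hq'.trans_le (min_le_right _ _)
    rw [hq]; push_cast; exact this
  have hq0 : (0 : ℝ) < q := by rw [hq]; positivity
  set η : ℝ := δ - 1 / q with hη
  have hη0 : 0 < η := by rw [hη]; linarith
  have hlog := Real.tendsto_log_atTop.comp (tendsto_natCast_atTop_atTop (R := ℝ))
  -- Half of `η m log m` pays for `35 log m` (33 from `r`, 2 from `m * m`), the other half for the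
  -- terms linear in `m`.
  filter_upwards [eventually_ge_atTop 100, tendsto_natCast_atTop_atTop.eventually_ge_atTop (70 / η),
    hlog.eventually_ge_atTop (2 * (Real.log 2 + Real.log q + Real.log 4) / η),
    hlog.eventually_ge_atTop (Real.log q)] with m hm100 hm70 hL hLq d hd0 hd
  simp only [Function.comp_apply] at hL hLq
  set L := Real.log (m : ℝ) with hLdef
  have hm100' : (100 : ℝ) ≤ m := by exact_mod_cast hm100
  have hm0 : (0 : ℝ) < m := by linarith
  have hL0 : 0 < L := Real.log_pos (by linarith)
  set k : ℕ := m / q + 1 with hk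
  have hk1 : (m : ℝ) / q ≤ k := by
    rw [hk]; push_cast
    have h : (m : ℝ) < (m / q : ℕ) * q + q := by
      exact_mod_cast Nat.lt_div_mul_add (a := m) (show 0 < q from Nat.succ_pos q')
    rw [div_le_iff₀ hq0]
    linarith
  have hk2 : (k : ℝ) ≤ m / q + 1 := by
    rw [hk]; push_cast
    have := Nat.cast_div_le (α := ℝ) (m := m) (n := q)
    linarith
  have hmq : (m : ℝ) / q ≤ m / 2 := by
    have := mul_le_mul_of_nonneg_left hq2.le hm0.le
    calc (m : ℝ) / q = m * (1 / q) := by ring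
      _ ≤ m * (1 / 2) := this
      _ = m / 2 := by ring
  have hkm : k + 32 ≤ m := by
    have : (k : ℝ) + 32 ≤ m := by linarith
    exact_mod_cast this
  have hkpos : (0 : ℝ) < k := by rw [hk]; positivity
  refine mem_cooperativeNumbers_of_le (k := k) (r := m - (k + 32)) (Nat.succ_pos _) hd0 (by omega) ?_
  have hr : (m : ℝ) - m / q - 33 ≤ ((m - (k + 32) : ℕ) : ℝ) := by
    rw [Nat.cast_sub hkm]; push_cast; linarith
  have hlogk : L - Real.log q ≤ Real.log k := by
    rw [hLdef, ← Real.log_div hm0.ne' hq0.ne']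
    exact Real.log_le_log (by positivity) hk1
  have hd0' : (0 : ℝ) < d := by exact_mod_cast hd0
  have h2 : 0 < Real.log 2 := Real.log_pos (by norm_num)
  have h4 : 0 < Real.log 4 := Real.log_pos (by norm_num)
  have hlq : 0 ≤ Real.log q := Real.log_natCast_nonneg q
  have key : m * Real.log 2 + (Real.log 4 + (L + L + Real.log d)) ≤
      ((m - (k + 32) : ℕ) : ℝ) * Real.log k := by
    have e1 : (m - m / q - 33) * (L - Real.log q) ≤
        ((m - (k + 32) : ℕ) : ℝ) * Real.log k :=
      mul_le_mul hr hlogk (by linarith) (by positivity)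
    have e2 : 35 * L ≤ η * m / 2 * L := by
      refine mul_le_mul_of_nonneg_right ?_ hL0.le
      rw [div_le_iff₀ hη0] at hm70
      linarith
    have e3 : m * (Real.log 2 + Real.log q + Real.log 4) ≤ η * m / 2 * L := by
      rw [div_le_iff₀ hη0] at hL
      nlinarith
    have e4 : Real.log 4 ≤ m * Real.log 4 := by nlinarith
    have e5 : 0 ≤ (m : ℝ) / q * Real.log q := by positivity
    have e6 : η * m * L = δ * (m * L) - m / q * L := by rw [hη]; ring
    nlinarith
  have hreal : (2 : ℝ) ^ m * (4 * (m * m * d)) ≤ (k : ℝ) ^ (m - (k + 32)) := by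
    rw [← Real.log_le_log_iff (by positivity) (by positivity), Real.log_pow,
      Real.log_mul (by positivity) (by positivity), Real.log_mul (by positivity) (by positivity),
      Real.log_mul (by positivity) (by positivity), Real.log_mul (by positivity) (by positivity),
      Real.log_pow]
    exact key
  exact_mod_cast hreal

theorem cooperativeNumbers_wheelFanClass_nonempty {d : ℕ} (hd : 0 < d) :
    (cooperativeNumbers wheelFanClass d).Nonempty := by
  have hlog := Real.tendsto_log_atTop.comp (tendsto_natCast_atTop_atTop (R := ℝ))
  obtain ⟨m, hm, h1, h2⟩ := ((eventually_mem_cooperativeNumbers (δ := 1 / 2)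
    (by norm_num)).and ((tendsto_natCast_atTop_atTop.eventually_ge_atTop
      (2 * Real.log d)).and (hlog.eventually_ge_atTop 1))).exists
  refine ⟨m, hm d hd ?_⟩
  simp only [Function.comp_apply] at h2
  have : (0 : ℝ) ≤ m := m.cast_nonneg
  nlinarith

theorem cooperativeNumber_mem {d : ℕ} (hd : 0 < d) :
    cooperativeNumber wheelFanClass d ∈ cooperativeNumbers wheelFanClass d :=
  Nat.sInf_mem (cooperativeNumbers_wheelFanClass_nonempty hd)

theorem tendsto_cooperativeNumber_atTop :
    Tendsto (cooperativeNumber wheelFanClass) atTop atTop := by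
  refine tendsto_atTop.2 fun b => ?_
  filter_upwards [eventually_ge_atTop ((b + 1) ^ b), eventually_gt_atTop 0] with d hd hd0
  by_contra hlt
  exact notMem_cooperativeNumbers_of_le hd
    (cooperativeNumbers_upward_closed (cooperativeNumber_mem hd0) (not_le.1 hlt).le)

/-- With `M = m(d)`, the quotient `log d / (M log M)` tends to `1`. -/
theorem tendsto_log_div_cooperativeNumber_mul_log :
    Tendsto (fun d : ℕ => Real.log d / ((cooperativeNumber wheelFanClass d : ℝ) *
      Real.log (cooperativeNumber wheelFanClass d))) atTop (𝓝 1) := by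
  set M := cooperativeNumber wheelFanClass with hM
  have hMt : Tendsto M atTop atTop := tendsto_cooperativeNumber_atTop
  have hMr : Tendsto (fun d => (M d : ℝ)) atTop atTop := tendsto_natCast_atTop_atTop.comp hMt
  have hMl : Tendsto (fun d => Real.log (M d)) atTop atTop := Real.tendsto_log_atTop.comp hMr
  have hl2 : Tendsto (fun d => Real.log 2 / Real.log (M d)) atTop (𝓝 0) :=
    hMl.const_div_atTop _
  have hl1 : Tendsto (fun d => 1 / (M d : ℝ)) atTop (𝓝 0) := hMr.const_div_atTop _
  refine tendsto_order.2 ⟨fun a ha => ?_, fun a ha => ?_⟩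
  -- Truncating at 0 keeps `1 - δ` nonnegative, and `1 - δ = (1 + b) / 2` exceeds `a`.
  · set b := max a 0 with hb
    have hb1 : b < 1 := max_lt ha one_pos
    set δ := (1 - b) / 2 with hδ
    have hδ0 : 0 < δ := by rw [hδ]; linarith
    have hlim : Tendsto (fun d => (1 - δ) * ((1 - 1 / (M d : ℝ)) *
        (1 - Real.log 2 / Real.log (M d)))) atTop (𝓝 ((1 - δ) * ((1 - 0) * (1 - 0)))) :=
      ((hl1.const_sub 1).mul (hl2.const_sub 1)).const_mul (1 - δ)
    have hab : a < (1 - δ) * ((1 - 0) * (1 - 0)) := by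
      have : a ≤ b := le_max_left _ _
      rw [hδ]; linarith
    have hMsub : Tendsto (fun d => M d - 1) atTop atTop := (tendsto_sub_atTop_nat 1).comp hMt
    filter_upwards [hlim.eventually_const_lt hab, eventually_gt_atTop 0,
      hMsub.eventually (eventually_mem_cooperativeNumbers hδ0),
      hMt.eventually_ge_atTop 2] with d h1 hd0 hU hM2
    have hM2' : (2 : ℝ) ≤ M d := by exact_mod_cast hM2
    have hL0 : 0 < Real.log (M d) := Real.log_pos (by linarith)
    -- By minimality `M d - 1` colors fail, so the sufficient condition for `M d - 1` must be
    -- violated.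
    have hnot : M d - 1 ∉ cooperativeNumbers wheelFanClass d :=
      Nat.notMem_of_lt_sInf (show M d - 1 < M d by omega)
    have hlt : (1 - δ) * (((M d - 1 : ℕ) : ℝ) * Real.log ((M d - 1 : ℕ) : ℝ)) < Real.log d := by
      by_contra hcon
      exact hnot (hU d hd0 (not_lt.1 hcon))
    rw [Nat.cast_sub (by omega), Nat.cast_one] at hlt
    refine h1.trans ((lt_div_iff₀ (by positivity)).2 ?_)
    have hlog : Real.log (M d) - Real.log 2 ≤ Real.log ((M d : ℝ) - 1) := by
      rw [← Real.log_div (by positivity) (by norm_num)]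
      exact Real.log_le_log (by positivity) (by linarith)
    have hδ1 : 0 ≤ 1 - δ := by
      have : 0 ≤ b := le_max_right _ _
      rw [hδ]; linarith
    calc _ = (1 - δ) * (((M d : ℝ) - 1) * (Real.log (M d) - Real.log 2)) := by
          field_simp
      _ ≤ (1 - δ) * (((M d : ℝ) - 1) * Real.log ((M d : ℝ) - 1)) := by
          refine mul_le_mul_of_nonneg_left (mul_le_mul_of_nonneg_left hlog ?_) hδ1
          linarith
      _ < _ := hlt
  · have hlim : Tendsto (fun d => 1 + Real.log 2 / Real.log (M d)) atTop (𝓝 (1 + 0)) :=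
      hl2.const_add 1
    filter_upwards [hlim.eventually_lt_const (by simpa using ha), eventually_gt_atTop 0,
      hMt.eventually_ge_atTop 2] with d h1 hd0 hM2
    have hM2' : (2 : ℝ) ≤ M d := by exact_mod_cast hM2
    have hL0 : 0 < Real.log (M d) := Real.log_pos (by linarith)
    refine lt_of_le_of_lt ((div_le_iff₀ (by positivity)).2 ?_) h1
    have hlt : d < (M d + 1) ^ M d := by
      by_contra hcon
      exact notMem_cooperativeNumbers_of_le (not_lt.1 hcon) (cooperativeNumber_mem hd0)
    have hltr : (d : ℝ) ≤ ((M d : ℝ) + 1) ^ M d := by exact_mod_cast hlt.le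
    have hd0' : (0 : ℝ) < d := by exact_mod_cast hd0
    calc Real.log d ≤ Real.log (((M d : ℝ) + 1) ^ M d) := Real.log_le_log hd0' hltr
      _ = M d * Real.log ((M d : ℝ) + 1) := Real.log_pow _ _
      _ ≤ M d * Real.log (2 * M d) := by
          refine mul_le_mul_of_nonneg_left (Real.log_le_log (by positivity) ?_) (by positivity)
          linarith
      _ = M d * (Real.log 2 + Real.log (M d)) := by
          rw [Real.log_mul (by norm_num) (by positivity)]
      _ = _ := by field_simp; ring

theorem mainTheorem7 :
    (∀ d : ℕ, 3 ≤ d → (cooperativeNumbers wheelFanClass d).Nonempty) ∧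
      ∃ ε : ℕ → ℝ, Tendsto ε atTop (𝓝 0) ∧
        ∀ d : ℕ, 3 ≤ d →
          (cooperativeNumber wheelFanClass d : ℝ) =
            (1 + ε d) * (Real.log d / Real.log (Real.log d)) := by
  refine ⟨fun d hd => cooperativeNumbers_wheelFanClass_nonempty (by omega), ?_⟩
  have hg := tendsto_log_div_cooperativeNumber_mul_log
  set M := cooperativeNumber wheelFanClass with hM
  have hMt : Tendsto M atTop atTop := tendsto_cooperativeNumber_atTop
  have hMr : Tendsto (fun d => (M d : ℝ)) atTop atTop := tendsto_natCast_atTop_atTop.comp hMt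
  have hMl : Tendsto (fun d => Real.log (M d)) atTop atTop := Real.tendsto_log_atTop.comp hMr
  have hloglog : ∀ d : ℕ, 3 ≤ d → 1 < Real.log d := by
    intro d hd
    have hd' : (3 : ℝ) ≤ d := by exact_mod_cast hd
    rw [Real.lt_log_iff_exp_lt (by linarith)]
    linarith [Real.exp_one_lt_d9]
  refine ⟨fun d => M d * Real.log (Real.log d) / Real.log d - 1, ?_, fun d hd => ?_⟩
  · have h1 : Tendsto (fun d : ℕ => Real.log (Real.log d / (M d * Real.log (M d))) /
        Real.log (M d)) atTop (𝓝 0) := by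
      have h0 : Tendsto (fun d : ℕ => Real.log (Real.log d / (M d * Real.log (M d)))) atTop
          (𝓝 0) := by
        have := (Real.continuousAt_log one_ne_zero).tendsto.comp hg
        rwa [Real.log_one] at this
      exact h0.div_atTop hMl
    have h2 : Tendsto (fun d : ℕ => Real.log (Real.log (M d)) / Real.log (M d)) atTop (𝓝 0) :=
      Real.isLittleO_log_id_atTop.tendsto_div_nhds_zero.comp hMl
    -- `log log d` equals `log M + log log M` plus the logarithm of a quotient tending to 1, so it
    -- is asymptotic to `log M`.
    have h3 : Tendsto (fun d : ℕ => Real.log (Real.log d) / Real.log (M d)) atTop (𝓝 1) := by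
      have h := (h1.add h2).const_add 1
      rw [add_zero, add_zero] at h
      refine h.congr' ?_
      filter_upwards [eventually_ge_atTop 3, hMt.eventually_ge_atTop 2] with d hd hM2
      have hM2' : (2 : ℝ) ≤ M d := by exact_mod_cast hM2
      have hL0 : 0 < Real.log (M d) := Real.log_pos (by linarith)
      have := hloglog d hd
      rw [Real.log_div (by positivity) (by positivity), Real.log_mul (by positivity) hL0.ne']
      field_simp
      ring
    have h4 := (h3.div hg one_ne_zero).sub_const 1
    rw [div_one, sub_self] at h4
    refine h4.congr' ?_
    filter_upwards [eventually_ge_atTop 3, hMt.eventually_ge_atTop 2] with d hd hM2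
    have hM2' : (2 : ℝ) ≤ M d := by exact_mod_cast hM2
    have hL0 : 0 < Real.log (M d) := Real.log_pos (by linarith)
    have := hloglog d hd
    simp only [Pi.div_apply]
    field_simp
  · have h1 := hloglog d hd
    have h2 : 0 < Real.log (Real.log d) := Real.log_pos h1
    have h3 : 0 < Real.log d := by linarith
    field_simp
    ring
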